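/- Let $(X,d)$ be a metric space, let $p$ be a limit (accumulation) point of $X$, and let $s_1>0$. **Pretangent spaces.** A normalizing sequence is a sequence $\tilde r=(r_n)$ of positive reals with $r_n\to 0$. Sequences $\tilde x=(x_n)$, $\tilde y=(y_n)$ in $X$ are mutually stable w.r.t. $\tilde r$ if the finite limit $\tilde d_{\tilde r}(\tilde x,\tilde y)=\lim_n d(x_n,y_n)/r_n$ exists. A family of sequences is self-stable if any two of its members are mutually stable, and maximal self-stable if moreover every sequence outside it fails to be mutually stable with some member. Let $\tilde X_{p,\tilde r}$ be a maximal self-stable family containing the constant sequence $(p,p,\dots)$. The metric identification $(\Omega_{p,\tilde r},\rho)$ of the pseudometric space $(\tilde X_{p,\tilde r},\tilde d_{\tilde r})$ is called a pretangent space to $X$ at $p$. For a strictly increasing sequence $(n_k)$ put $\tilde r'=(r_{n_k})$ and $\tilde x'=(x_{n_k})$. If $\tilde X_{p,\tilde r'}$ is a maximal self-stable family w.r.t. $\tilde r'$ containing all $\tilde x'$ with $\tilde x\in\tilde X_{p,\tilde r}$, then $\tilde x\mapsto\tilde x'$ induces a distance-preserving map $em':\Omega_{p,\tilde r}\to\Omega_{p,\tilde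 r'}$. The pretangent space $\Omega_{p,\tilde r}$ is tangent if $em'$ is an isometry onto $\Omega_{p,\tilde r'}$ for all such $(n_k)$ and $\tilde X_{p,\tilde r'}$. **The limit condition.** Let $X^{+3}$ be the set of triples $(x,y,z)\in X^3$ with $d(x,z)\ge d(x,y)\ge d(y,z)>0$. For $(x,y,z)\in X^{+3}$ let $\sigma(x,y,z)\in[1,\infty)$ be the unique $s\ge 1$ with $d(x,y)^s+d(y,z)^s=d(x,z)^s$ if $d(x,y)\vee d(y,z)<d(x,z)$, and $\sigma(x,y,z)=\infty$ otherwise. Put $$F(x,y)=\frac{d(x,y)\,(d(x,p)\wedge d(y,p))}{(d(x,p)\vee d(y,p))^2}\ \text{ for }(x,y)\ne(p,p),\qquad F(p,p)=0,$$ $$\Phi(x,y,z)=F(x,y)\vee F(x,z)\vee F(y,z),\qquad \Psi(x,y,z)=\frac{d(x,y)\vee d(y,z)\vee d(x,z)}{d(x,y)\wedge d(y,z)\wedge d(x,z)}.$$ Consider the condition $$\lim_{\substack{x,y,z\to p\\(x,y,z)\in X^{+3}}}\frac{\Psi(x,y,z)}{\Phi(x,y,z)}\left(\frac{\sigma(x,y,z)}{s_1-\sigma(x,y,z)}\right)^2=\infty,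 \tag{3.3}$$ where the squared factor is $1$ if $\sigma(x,y,z)=\infty$ and is $\infty$ if $\sigma(x,y,z)=s_1$. **Corollary 3.4.** Suppose that (3.3) holds for $s_1$, and let $(\Omega_{p,\tilde r},\rho)$ be a pretangent space to $X$ at $p$. Each of the following conditions is sufficient for $(\Omega_{p,\tilde r},\rho)$ to be tangent: (i) there is no isometric embedding of $(\Omega_{p,\tilde r},\rho^{s_1})$ into $\mathbb R$, that is, no $f:\Omega_{p,\tilde r}\to\mathbb R$ with $|f(\alpha)-f(\beta)|=\rho(\alpha,\beta)^{s_1}$ for all $\alpha,\beta$; (ii) $(\Omega_{p,\tilde r},\rho^{s_1})$ is isometric to $\mathbb R$ with its usual metric, that is, there is a surjective such $f$. -/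

import Mathlib

open Filter Topology
open scoped ENNReal

namespace Pretangent

/-- A normalizing sequence: positive real numbers tending to zero. -/
structure NormalizingSequence where
  seq : ℕ → ℝ
  pos : ∀ n, 0 < seq n
  tendsto_zero : Tendsto seq atTop (𝓝 0)

/-- The subsequence `r_{φ 0}, r_{φ 1}, …` of a normalizing sequence. -/
def NormalizingSequence.subseq (r : NormalizingSequence) (φ : ℕ → ℕ) (hφ : StrictMono φ) :
    NormalizingSequence where
  seq := r.seq ∘ φ
  pos := fun n => r.pos (φ n)
  tendsto_zero := r.tendsto_zero.comp hφ.tendsto_atTop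

section Families

variable {X : Type*} [MetricSpace X]

/-- Two sequences are mutually stable with respect to `r` if `d(x_n, y_n) / r_n` has a finite
limit. -/
def MutuallyStable (r : NormalizingSequence) (x y : ℕ → X) : Prop :=
  ∃ L : ℝ, Tendsto (fun n => dist (x n) (y n) / r.seq n) atTop (𝓝 L)

/-- The limit of `d(x_n, y_n) / r_n` (used for mutually stable sequences only). -/
noncomputable def seqDist (r : NormalizingSequence) (x y : ℕ → X) : ℝ :=
  limUnder atTop (fun n => dist (x n) (y n) / r.seq n)

theorem MutuallyStable.tendsto {r : NormalizingSequence} {x y : ℕ → X}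
    (h : MutuallyStable r x y) :
    Tendsto (fun n => dist (x n) (y n) / r.seq n) atTop (𝓝 (seqDist r x y)) :=
  tendsto_nhds_limUnder h

/-- Every two members of the family are mutually stable. -/
def SelfStable (r : NormalizingSequence) (F : Set (ℕ → X)) : Prop :=
  ∀ x ∈ F, ∀ y ∈ F, MutuallyStable r x y

/-- A maximal self-stable family. -/
def MaximalSelfStable (r : NormalizingSequence) (F : Set (ℕ → X)) : Prop :=
  SelfStable r F ∧ ∀ z, z ∉ F → ∃ x ∈ F, ¬ MutuallyStable r x z

/-- A maximal self-stable family of sequences in `X` that contains the constant sequence `p`. -/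
structure Family (p : X) (r : NormalizingSequence) where
  carrier : Set (ℕ → X)
  maximal : MaximalSelfStable r carrier
  const_mem : (fun _ => p) ∈ carrier

variable {p : X} {r : NormalizingSequence}

/-- The members of the family, as a type of its own (it carries the limit pseudometric and not
the topology of pointwise convergence). -/
structure Family.Point (F : Family p r) where
  val : ℕ → X
  mem : val ∈ F.carrier

theorem Family.Point.tendsto {F : Family p r} (x y : F.Point) :
    Tendsto (fun n => dist (x.val n) (y.val n) / r.seq n) atTop
      (𝓝 (seqDist r x.val y.val)) :=
  (F.maximal.1 _ x.mem _ y.mem).tendsto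

/-- The limit pseudometric on a maximal self-stable family. -/
noncomputable instance Family.instPseudoMetricSpacePoint (F : Family p r) :
    PseudoMetricSpace F.Point where
  dist x y := seqDist r x.val y.val
  dist_self x := by
    refine tendsto_nhds_unique (x.tendsto x) ?_
    simp
  dist_comm x y := by
    refine tendsto_nhds_unique (x.tendsto y) ?_
    simpa only [dist_comm] using y.tendsto x
  dist_triangle x y z := by
    refine le_of_tendsto_of_tendsto' (x.tendsto z) ((x.tendsto y).add (y.tendsto z)) ?_
    intro n
    rw [← add_div]
    exact div_le_div_of_nonneg_right (dist_triangle _ _ _) (r.pos n).le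

theorem Family.dist_point (F : Family p r) (x y : F.Point) :
    dist x y = seqDist r x.val y.val := rfl

/-- The pretangent space of a maximal self-stable family: its metric identification, that is,
the metric space of classes of points at distance zero. -/
abbrev Family.Space (F : Family p r) : Type _ := SeparationQuotient F.Point

/-- The map `x ↦ x'` (passage to the subsequence `φ`) between maximal self-stable families. -/
def Family.inMap (F : Family p r) {φ : ℕ → ℕ} {hφ : StrictMono φ}
    (F' : Family p (r.subseq φ hφ)) (h : ∀ x ∈ F.carrier, x ∘ φ ∈ F'.carrier)
    (x : F.Point) : F'.Point :=
  ⟨x.val ∘ φ, h x.val x.mem⟩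

theorem Family.isometry_inMap (F : Family p r) {φ : ℕ → ℕ} {hφ : StrictMono φ}
    (F' : Family p (r.subseq φ hφ)) (h : ∀ x ∈ F.carrier, x ∘ φ ∈ F'.carrier) :
    Isometry (F.inMap F' h) := by
  refine Isometry.of_dist_eq fun x y => ?_
  exact tendsto_nhds_unique ((F.inMap F' h x).tendsto (F.inMap F' h y))
    ((x.tendsto y).comp hφ.tendsto_atTop)

/-- The map between pretangent spaces induced by passing to the subsequence `φ`. -/
noncomputable def Family.emMap (F : Family p r) {φ : ℕ → ℕ} {hφ : StrictMono φ}
    (F' : Family p (r.subseq φ hφ)) (h : ∀ x ∈ F.carrier, x ∘ φ ∈ F'.carrier) :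
    F.Space → F'.Space :=
  SeparationQuotient.lift (fun x => SeparationQuotient.mk (F.inMap F' h x)) fun _ _ hxy =>
    SeparationQuotient.mk_eq_mk.2 (hxy.map (F.isometry_inMap F' h).continuous)

/-- A pretangent space is tangent if, for every subsequence and every maximal self-stable family
along it that contains all `x'`, the induced map is an isometry onto. -/
def Family.IsTangent (F : Family p r) : Prop :=
  ∀ (φ : ℕ → ℕ) (hφ : StrictMono φ) (F' : Family p (r.subseq φ hφ))
    (h : ∀ x ∈ F.carrier, x ∘ φ ∈ F'.carrier),
    Isometry (F.emMap F' h) ∧ Function.Surjective (F.emMap F' h)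

end Families

section Betweenness

/-- If `a, b < c ≤ a + b` with `a, b > 0`, then `a ^ s + b ^ s = c ^ s` has exactly one solution
`s ∈ [1, ∞)`. -/
theorem existsUnique_exponent {a b c : ℝ} (ha : 0 < a) (hb : 0 < b) (hac : a < c) (hbc : b < c)
    (habc : c ≤ a + b) : ∃! s : ℝ, 1 ≤ s ∧ a ^ s + b ^ s = c ^ s := by
  have hc : 0 < c := ha.trans hac
  have hu0 : 0 < a / c := div_pos ha hc
  have hv0 : 0 < b / c := div_pos hb hc
  have hu1 : a / c < 1 := (div_lt_one hc).2 hac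
  have hv1 : b / c < 1 := (div_lt_one hc).2 hbc
  have key : ∀ s : ℝ, a ^ s + b ^ s = c ^ s ↔ (a / c) ^ s + (b / c) ^ s = 1 := by
    intro s
    have hcs : 0 < c ^ s := Real.rpow_pos_of_pos hc s
    rw [Real.div_rpow ha.le hc.le, Real.div_rpow hb.le hc.le, ← add_div, div_eq_one_iff_eq hcs.ne']
  have hanti : StrictAnti fun s : ℝ => (a / c) ^ s + (b / c) ^ s := fun s t hst =>
    add_lt_add (Real.rpow_lt_rpow_of_exponent_gt hu0 hu1 hst)
      (Real.rpow_lt_rpow_of_exponent_gt hv0 hv1 hst)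
  have hcont : Continuous fun s : ℝ => (a / c) ^ s + (b / c) ^ s :=
    (Real.continuous_const_rpow hu0.ne').add (Real.continuous_const_rpow hv0.ne')
  have hlim : Tendsto (fun s : ℝ => (a / c) ^ s + (b / c) ^ s) atTop (𝓝 (0 + 0)) :=
    (tendsto_rpow_atTop_of_base_lt_one _ (by linarith) hu1).add
      (tendsto_rpow_atTop_of_base_lt_one _ (by linarith) hv1)
  obtain ⟨t, ht, ht1⟩ := ((hlim.eventually (gt_mem_nhds (by norm_num : (0 : ℝ) + 0 < 1))).and
    (eventually_ge_atTop (1 : ℝ))).exists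
  have h1 : 1 ≤ (a / c) ^ (1 : ℝ) + (b / c) ^ (1 : ℝ) := by
    rw [Real.rpow_one, Real.rpow_one, ← add_div]
    exact (one_le_div hc).2 habc
  obtain ⟨s, hs, hs'⟩ := intermediate_value_Icc' ht1 hcont.continuousOn ⟨ht.le, h1⟩
  refine ⟨s, ⟨hs.1, (key s).2 hs'⟩, ?_⟩
  rintro s₂ ⟨-, h₂⟩
  exact hanti.injective (((key s₂).1 h₂).trans hs'.symm)

variable {X : Type*} [MetricSpace X]

theorem existsUnique_exponent_dist {x y z : X} (h : max (dist x z) (dist z y) < dist x y) :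
    ∃! s : ℝ, 1 ≤ s ∧ dist x z ^ s + dist z y ^ s = dist x y ^ s := by
  obtain ⟨h1, h2⟩ := max_lt_iff.1 h
  refine existsUnique_exponent ?_ ?_ h1 h2 (dist_triangle _ _ _)
  · refine dist_pos.2 ?_
    rintro rfl
    exact lt_irrefl _ h2
  · refine dist_pos.2 ?_
    rintro rfl
    exact lt_irrefl _ h1

open Classical in
/-- `sExp x y z ∈ [1, ∞]` is the unique root `s ∈ [1, ∞)` of
`d(x,z)^s + d(z,y)^s = d(x,y)^s` if `max (d(x,z)) (d(z,y)) < d(x,y)`, and `∞` otherwise.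
Note that the third argument is the intermediate point. -/
noncomputable def sExp (x y z : X) : ℝ≥0∞ :=
  if h : max (dist x z) (dist z y) < dist x y then
    ENNReal.ofReal (Classical.choose (existsUnique_exponent_dist h).exists)
  else ⊤

/-- The set `X^{+3}` of triples with `d(x,z) ≥ d(x,y) ≥ d(y,z) > 0`. -/
def orderedTriples (X : Type*) [MetricSpace X] : Set (X × X × X) :=
  {t | dist t.1 t.2.2 ≥ dist t.1 t.2.1 ∧ dist t.1 t.2.1 ≥ dist t.2.1 t.2.2 ∧
    dist t.2.1 t.2.2 > 0}

open Classical in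
/-- `F(x,y) = d(x,y) min(d(x,p), d(y,p)) / max(d(x,p), d(y,p))²`, and `F(p,p) = 0`. -/
noncomputable def Ffun (p x y : X) : ℝ :=
  if (x, y) = (p, p) then 0
  else dist x y * min (dist x p) (dist y p) / max (dist x p) (dist y p) ^ 2

noncomputable def Phi (p x y z : X) : ℝ :=
  max (max (Ffun p x y) (Ffun p x z)) (Ffun p y z)

open Classical in
/-- The ratio of the largest and the smallest distance of a triple (`∞` if the smallest is `0`). -/
noncomputable def Psi (x y z : X) : ℝ≥0∞ :=
  if min (min (dist x y) (dist y z)) (dist z x) = 0 then ⊤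
  else ENNReal.ofReal
    (max (max (dist x y) (dist y z)) (dist x z) / min (min (dist x y) (dist y z)) (dist z x))

open Classical in
/-- `s² / (s₁ - s)²` in `[0, ∞]`, with the value `1` for `s = ∞` (and `∞` for `s = s₁ > 0`). -/
noncomputable def sqRatio (s₁ : ℝ) (s : ℝ≥0∞) : ℝ≥0∞ :=
  if s = ⊤ then 1
  else ENNReal.ofReal (s.toReal ^ 2) / ENNReal.ofReal ((s₁ - s.toReal) ^ 2)

/-- The limit relation
`lim Ψ(x,y,z) s(x,z,y)² / (Φ(x,y,z) (s₁ - s(x,z,y))²) = ∞` as `x, y, z → p` within `X^{+3}`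
(with `1 / 0 = ∞`). For a triple in `X^{+3}` the longest side is `xz`, so that the exponent is
the one of `y` relative to the pair `x, z`. -/
def LimitRelation (p : X) (s₁ : ℝ) : Prop :=
  Tendsto
    (fun t : X × X × X =>
      Psi t.1 t.2.1 t.2.2 * sqRatio s₁ (sExp t.1 t.2.2 t.2.1) /
        ENNReal.ofReal (Phi p t.1 t.2.1 t.2.2))
    (𝓝[orderedTriples X] (p, p, p)) (𝓝 ⊤)

/-- `f` is distance-preserving from `(Y, ρ^s)` to the real line with its usual metric. -/
def PowIsometry {Y : Type*} [MetricSpace Y] (s : ℝ) (f : Y → ℝ) : Prop :=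
  ∀ a b : Y, |f a - f b| = dist a b ^ s

end Betweenness

end Pretangent

/-! `Psi` and `Phi` are scale invariant. Along three sequences with distinct classes, dividing
distances by `r_n` shows that `Psi` stays bounded and `Phi` stays away from zero, so the limit
relation forces the exponents to tend to `s₁`. Hence `ρ ^ s₁` is additive on every triple of a
pretangent space, and Menger's theorem leaves two cases: the space with `ρ ^ s₁` embeds in the line,
or it has exactly four points (`Family.exists_powIsometry_or_card_eq_four`). This holds along every
subsequence too.

The map `em'` always preserves distances, so only surjectivity is at stake. Without an embedding,
source and target both have four points, and an injection between them is onto. If the source is the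
whole line, the target is infinite, hence lies in the line; an isometric copy of the line inside the
line is all of it. -/

namespace Pretangent

/-! ### Menger's theorem for the line -/

section Menger

/-- Three points, with distances given by `D`, are isometric to three points of the line. -/
def LinearTriple {Y : Type*} (D : Y → Y → ℝ) (a b c : Y) : Prop :=
  D a b + D b c = D a c ∨ D a c + D c b = D a b ∨ D b a + D a c = D b c

/-- Two numbers of absolute values `|u|` and `|v|` at a "linear" distance `d`. -/
theorem eq_abs_sub_or_eq_abs_add {u v d : ℝ} (hd : 0 ≤ d)
    (h : |u| + d = |v| ∨ |v| + d = |u| ∨ |u| + |v| = d) : d = |u - v| ∨ d = |u + v| := by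
  rcases abs_cases u with ⟨h1, _⟩ | ⟨h1, _⟩ <;> rcases abs_cases v with ⟨h2, _⟩ | ⟨h2, _⟩ <;>
  rcases abs_cases (u - v) with ⟨h3, _⟩ | ⟨h3, _⟩ <;>
  rcases abs_cases (u + v) with ⟨h4, _⟩ | ⟨h4, _⟩ <;>
  rw [h1, h2] at h <;> rw [h3, h4] <;> rcases h with h | h | h <;>
  first
  | (left; linarith)
  | (right; linarith)

/-- Places a point on the line from its distances to reference points at `0` and `c`; the sign
depends on which of the three lies between the others. -/
theorem exists_coordinate {c a b : ℝ} (hc : 0 < c) (ha : 0 ≤ a) (hb : 0 ≤ b)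
    (h : c + b = a ∨ a + b = c ∨ c + a = b) : ∃ u : ℝ, |u| = a ∧ |u - c| = b := by
  rcases h with h | h | h
  · exact ⟨a, abs_of_nonneg ha, by rw [abs_of_nonneg] <;> linarith⟩
  · exact ⟨a, abs_of_nonneg ha, by rw [abs_of_nonpos] <;> linarith⟩
  · exact ⟨-a, by rw [abs_neg, abs_of_nonneg ha], by rw [abs_of_nonpos] <;> linarith⟩

/-- Menger's theorem for the line: if all triples are linear, then the whole space embeds into the
line, or it has exactly four points. -/
theorem exists_embedding_or_card_eq_four {Y : Type*} (D : Y → Y → ℝ)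
    (hnonneg : ∀ a b, 0 ≤ D a b) (hsymm : ∀ a b, D a b = D b a)
    (hzero : ∀ a b, D a b = 0 ↔ a = b) (hlin : ∀ a b c, LinearTriple D a b c) :
    (∃ f : Y → ℝ, ∀ a b, |f a - f b| = D a b) ∨ Nat.card Y = 4 := by
  by_cases hsub : Subsingleton Y
  · exact Or.inl ⟨fun _ => 0, fun a b => by
      rw [sub_self, abs_zero, eq_comm, hzero]; exact Subsingleton.elim a b⟩
  obtain ⟨o, e, hoe⟩ : ∃ o e : Y, o ≠ e := by
    by_contra! h
    exact hsub ⟨h⟩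
  obtain ⟨c, hc⟩ : ∃ c, c = D o e := ⟨_, rfl⟩
  have hc0 : 0 < c := by
    rw [hc]
    exact lt_of_le_of_ne (hnonneg _ _) fun h => hoe ((hzero _ _).1 h.symm)
  have hcoord : ∀ x, ∃ u : ℝ, |u| = D o x ∧ |u - c| = D e x := by
    intro x
    refine exists_coordinate hc0 (hnonneg _ _) (hnonneg _ _) ?_
    have h := hlin o e x
    rw [LinearTriple, hsymm x e, hsymm e o, ← hc] at h
    exact h
  choose f hfo hfe using hcoord
  by_cases hbad : ∀ a b, |f a - f b| = D a b
  · exact Or.inl ⟨f, hbad⟩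
  right
  -- Linearity with `o` fixes `D a b` up to reflecting one point in `0`, linearity with `e` up to
  -- reflecting it in `c`. If both reflections are needed, `|f a + f b| = |f a + f b - 2c|`, so `f a
  -- + f b = c`.
  have hbad_iff : ∀ a b, |f a - f b| = D a b ∨ (f a + f b = c ∧ D a b = c) := by
    intro a b
    have h1 : D a b = |f a - f b| ∨ D a b = |f a + f b| := by
      apply eq_abs_sub_or_eq_abs_add (hnonneg a b)
      rw [hfo, hfo]
      have h := hlin o a b
      rw [LinearTriple, hsymm b a, hsymm a o] at h
      exact h
    have h2 : D a b = |(f a - c) - (f b - c)| ∨ D a b = |(f a - c) + (f b - c)| := by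
      apply eq_abs_sub_or_eq_abs_add (hnonneg a b)
      rw [hfe, hfe]
      have h := hlin e a b
      rw [LinearTriple, hsymm b a, hsymm a e] at h
      exact h
    rw [sub_sub_sub_cancel_right] at h2
    rcases h1 with h1 | h1
    · exact Or.inl h1.symm
    rcases h2 with h2 | h2
    · exact Or.inl h2.symm
    right
    rcases abs_eq_abs.1 (h1.symm.trans h2) with h | h
    · linarith
    · have : f a + f b = c := by linarith
      exact ⟨this, by rw [h1, this, abs_of_pos hc0]⟩
  push Not at hbad
  obtain ⟨x, y, hxy⟩ := hbad
  obtain ⟨hsum, hD⟩ := (hbad_iff x y).resolve_left hxy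
  have hx0 : f x ≠ 0 := by
    intro h
    apply hxy
    rw [hD, show f y = c by linarith, h, zero_sub, abs_neg, abs_of_pos hc0]
  have hxc : f x ≠ c := by
    intro h
    apply hxy
    rw [hD, show f y = 0 by linarith, h, sub_zero, abs_of_pos hc0]
  have hfo0 : f o = 0 := by
    rw [← abs_eq_zero, hfo, hzero]
  have hfec : f e = c := by
    rw [← sub_eq_zero, ← abs_eq_zero, hfe, hzero]
  have hxne : x ≠ y := fun h => hc0.ne' (hD.symm.trans ((hzero _ _).2 h))
  have hox : o ≠ x := fun h => hx0 (by rw [← h, hfo0])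
  have hex : e ≠ x := fun h => hxc (by rw [← h, hfec])
  have hoy : o ≠ y := fun h => hxc (by rw [← h, hfo0] at hsum; linarith)
  have hey : e ≠ y := fun h => hx0 (by rw [← h, hfec] at hsum; linarith)
  -- A fifth point cannot accompany an exceptional pair. If `w` is exceptional with just one of `x`,
  -- `y`, it coincides with the other; if with both, `w, x, y` is equilateral with side `c > 0`; if
  -- with neither, one of `f x`, `f w` is `0` or `c`.
  have hall : ∀ w, w = o ∨ w = e ∨ w = x ∨ w = y := by
    intro w
    by_contra! hw
    obtain ⟨hwo, hwe, hwx, hwy⟩ := hw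
    have hw0 : f w ≠ 0 := fun h => hwo ((hzero _ _).1 (by rw [← hfo, h, abs_zero])).symm
    have hwc : f w ≠ c := fun h =>
      hwe ((hzero _ _).1 (by rw [← hfe, h, sub_self, abs_zero])).symm
    have hL := hlin w x y
    rw [LinearTriple, hsymm x w, hsymm y x, hD] at hL
    rcases hbad_iff w x with h1 | ⟨h1, h1'⟩ <;> rcases hbad_iff w y with h2 | ⟨h2, h2'⟩
    · rw [← h1, ← h2] at hL
      have h3 : c = |(f w - f x) - (f w - f y)| ∨ c = |(f w - f x) + (f w - f y)| := by
        exact eq_abs_sub_or_eq_abs_add hc0.le hL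
      rcases h3 with h3 | h3 <;> rcases (abs_eq hc0.le).1 h3.symm with h4 | h4
      · exact hx0 (by linarith)
      · exact hxc (by linarith)
      · exact hwc (by linarith)
      · exact hw0 (by linarith)
    · refine hwx ((hzero _ _).1 ?_)
      rw [← h1, show f w = f x by linarith, sub_self, abs_zero]
    · refine hwy ((hzero _ _).1 ?_)
      rw [← h2, show f w = f y by linarith, sub_self, abs_zero]
    · rw [h1', h2'] at hL
      rcases hL with h | h | h <;> linarith
  classical
  have hcard : (Set.univ : Set Y) = ({o, e, x, y} : Finset Y) := by
    ext w
    simpa using hall w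
  rw [← Set.ncard_univ, hcard, Set.ncard_coe_finset]
  simp [*]

end Menger

/-! ### Passing to the limit in the exponent equation -/

section Limits

variable {X : Type*} [MetricSpace X] {ι : Type*} {l : Filter ι}

theorem tendsto_toReal_of_sqRatio {s₁ : ℝ} (hs₁ : 0 < s₁) {σ : ι → ℝ≥0∞}
    (h : Tendsto (fun i => sqRatio s₁ (σ i)) l (𝓝 ⊤)) :
    (∀ᶠ i in l, σ i ≠ ⊤) ∧ Tendsto (fun i => (σ i).toReal) l (𝓝 s₁) := by
  have hfin : ∀ᶠ i in l, σ i ≠ ⊤ := by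
    filter_upwards [ENNReal.tendsto_nhds_top_iff_nnreal.1 h 1] with i hi htop
    rw [sqRatio, if_pos htop] at hi
    exact lt_irrefl _ hi
  refine ⟨hfin, Metric.tendsto_nhds.2 fun ε hε => ?_⟩
  have hq : 0 < 2 * s₁ / ε := by positivity
  -- From `M * |s₁ - s| < s`, the summand `2` gives `s < 2 * s₁`, and then `2 * s₁ / ε` gives `|s₁ -
  -- s| < ε`.
  obtain ⟨M, hM⟩ : ∃ M, M = 2 + 2 * s₁ / ε := ⟨_, rfl⟩
  filter_upwards [hfin, ENNReal.tendsto_nhds_top_iff_nnreal.1 h (M ^ 2).toNNReal] with i hi hlt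
  have hs : 0 ≤ (σ i).toReal := ENNReal.toReal_nonneg
  rw [sqRatio, if_neg hi] at hlt
  obtain ⟨s, hs_def⟩ : ∃ s, s = (σ i).toReal := ⟨_, rfl⟩
  rw [← hs_def] at hlt hs ⊢
  have h1 := ENNReal.mul_lt_of_lt_div hlt
  rw [← ENNReal.ofReal, ← ENNReal.ofReal_mul (sq_nonneg _), ← mul_pow] at h1
  have h2 := abs_lt_of_sq_lt_sq ((ENNReal.ofReal_lt_ofReal_iff').1 h1).1 hs
  rw [abs_mul, abs_of_pos (by linarith)] at h2
  rw [Real.dist_eq, abs_sub_comm]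
  have h3 : 2 * |s₁ - s| < s :=
    (mul_le_mul_of_nonneg_right (by linarith) (abs_nonneg _)).trans_lt h2
  have h4 : s < 2 * s₁ := by linarith [neg_abs_le (s₁ - s)]
  have h5 : 2 * s₁ / ε * |s₁ - s| < 2 * s₁ :=
    (mul_le_mul_of_nonneg_right (by linarith) (abs_nonneg _)).trans_lt (h2.trans h4)
  rw [div_mul_eq_mul_div, div_lt_iff₀ hε] at h5
  exact lt_of_mul_lt_mul_left h5 (by positivity)

theorem sExp_spec {x y z : X} (h : sExp x y z ≠ ⊤) :
    dist x z ^ (sExp x y z).toReal + dist z y ^ (sExp x y z).toReal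
      = dist x y ^ (sExp x y z).toReal := by
  unfold sExp at h ⊢
  split_ifs at h ⊢ with hlt
  · have hs := Classical.choose_spec (existsUnique_exponent_dist hlt).exists
    rw [ENNReal.toReal_ofReal (by linarith [hs.1])]
    exact hs.2
  · exact absurd rfl h

theorem Ffun_eq (p x y : X) :
    Ffun p x y = dist x y * min (dist x p) (dist y p) / max (dist x p) (dist y p) ^ 2 := by
  unfold Ffun
  split_ifs with h
  · obtain ⟨rfl, rfl⟩ := Prod.mk.inj h
    simp
  · rfl

theorem Ffun_eq_div {ρ : ℝ} (hρ : 0 < ρ) (p x y : X) :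
    Ffun p x y = dist x y / ρ * min (dist x p / ρ) (dist y p / ρ) /
      max (dist x p / ρ) (dist y p / ρ) ^ 2 := by
  rw [Ffun_eq, min_div_div_right hρ.le, max_div_div_right hρ.le]
  field_simp

variable {p : X} {ρ : ι → ℝ} {x y z : ι → X}

theorem exists_eventually_lt_Ffun (hρ : ∀ i, 0 < ρ i) {a b d : ℝ}
    (hx : Tendsto (fun i => dist (x i) p / ρ i) l (𝓝 a))
    (hy : Tendsto (fun i => dist (y i) p / ρ i) l (𝓝 b))
    (hxy : Tendsto (fun i => dist (x i) (y i) / ρ i) l (𝓝 d))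
    (ha : 0 < a) (hb : 0 < b) (hd : 0 < d) :
    ∃ δ > 0, ∀ᶠ i in l, δ < Ffun p (x i) (y i) := by
  have hmax : 0 < max a b := lt_max_of_lt_left ha
  have hlim : Tendsto (fun i => Ffun p (x i) (y i)) l (𝓝 (d * min a b / max a b ^ 2)) := by
    refine ((hxy.mul (hx.min hy)).div ((hx.max hy).pow 2) (by positivity)).congr fun i => ?_
    exact (Ffun_eq_div (hρ i) p (x i) (y i)).symm
  have hpos : 0 < d * min a b / max a b ^ 2 := by
    have := lt_min ha hb
    positivity
  exact ⟨_, half_pos hpos, hlim.eventually (lt_mem_nhds (half_lt_self hpos))⟩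

theorem exists_eventually_lt_Phi (hρ : ∀ i, 0 < ρ i) {a b c d e f : ℝ}
    (hx : Tendsto (fun i => dist (x i) p / ρ i) l (𝓝 a))
    (hy : Tendsto (fun i => dist (y i) p / ρ i) l (𝓝 b))
    (hz : Tendsto (fun i => dist (z i) p / ρ i) l (𝓝 c))
    (hxy : Tendsto (fun i => dist (x i) (y i) / ρ i) l (𝓝 d))
    (hyz : Tendsto (fun i => dist (y i) (z i) / ρ i) l (𝓝 e))
    (hxz : Tendsto (fun i => dist (x i) (z i) / ρ i) l (𝓝 f))
    (hd : 0 < d) (he : 0 < e) (hf : 0 < f)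
    (h : 0 < a ∧ 0 < b ∨ 0 < b ∧ 0 < c ∨ 0 < a ∧ 0 < c) :
    ∃ δ > 0, ∀ᶠ i in l, δ < Phi p (x i) (y i) (z i) := by
  rcases h with ⟨h1, h2⟩ | ⟨h1, h2⟩ | ⟨h1, h2⟩
  · obtain ⟨δ, hδ, H⟩ := exists_eventually_lt_Ffun hρ hx hy hxy h1 h2 hd
    exact ⟨δ, hδ, H.mono fun i hi => lt_max_of_lt_left (lt_max_of_lt_left hi)⟩
  · obtain ⟨δ, hδ, H⟩ := exists_eventually_lt_Ffun hρ hy hz hyz h1 h2 he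
    exact ⟨δ, hδ, H.mono fun i hi => lt_max_of_lt_right hi⟩
  · obtain ⟨δ, hδ, H⟩ := exists_eventually_lt_Ffun hρ hx hz hxz h1 h2 hf
    exact ⟨δ, hδ, H.mono fun i hi => lt_max_of_lt_left (lt_max_of_lt_right hi)⟩

theorem exists_eventually_Psi_le (hρ : ∀ i, 0 < ρ i) {d e f : ℝ}
    (hxy : Tendsto (fun i => dist (x i) (y i) / ρ i) l (𝓝 d))
    (hyz : Tendsto (fun i => dist (y i) (z i) / ρ i) l (𝓝 e))
    (hxz : Tendsto (fun i => dist (x i) (z i) / ρ i) l (𝓝 f))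
    (hd : 0 < d) (he : 0 < e) (hf : 0 < f) :
    ∃ K > 0, ∀ᶠ i in l, Psi (x i) (y i) (z i) ≤ ENNReal.ofReal K := by
  have hmin : 0 < min (min d e) f := lt_min (lt_min hd he) hf
  have hlim_min := (hxy.min hyz).min hxz
  have hlim := ((hxy.max hyz).max hxz).div hlim_min hmin.ne'
  have hK : 0 < max (max d e) f / min (min d e) f :=
    div_pos (lt_max_of_lt_right hf) hmin
  refine ⟨max (max d e) f / min (min d e) f + 1, by positivity, ?_⟩
  filter_upwards [hlim_min.eventually (lt_mem_nhds hmin),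
    hlim.eventually (gt_mem_nhds (lt_add_one _))] with i h1 h2
  have hr := hρ i
  rw [min_div_div_right hr.le, min_div_div_right hr.le] at h1
  simp only [Pi.div_apply] at h2
  rw [min_div_div_right hr.le, min_div_div_right hr.le, max_div_div_right hr.le,
    max_div_div_right hr.le, div_div_div_cancel_right₀ hr.ne'] at h2
  have h3 : 0 < min (min (dist (x i) (y i)) (dist (y i) (z i))) (dist (x i) (z i)) :=
    (div_pos_iff_of_pos_right hr).1 h1
  rw [Psi, dist_comm (z i) (x i), if_neg h3.ne']
  exact ENNReal.ofReal_le_ofReal h2.le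

/-- Along triples of sequences that are ordered and have distinct limits, the limit distances
satisfy the equation with the exponent of the limit relation. -/
theorem LimitRelation.rpow_add_rpow_eq {s₁ : ℝ} (hs₁ : 0 < s₁) (hlim : LimitRelation p s₁)
    [l.NeBot] (hρ : ∀ i, 0 < ρ i) (hρ0 : Tendsto ρ l (𝓝 0)) {a b c d e f : ℝ}
    (hx : Tendsto (fun i => dist (x i) p / ρ i) l (𝓝 a))
    (hy : Tendsto (fun i => dist (y i) p / ρ i) l (𝓝 b))
    (hz : Tendsto (fun i => dist (z i) p / ρ i) l (𝓝 c))
    (hxy : Tendsto (fun i => dist (x i) (y i) / ρ i) l (𝓝 d))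
    (hyz : Tendsto (fun i => dist (y i) (z i) / ρ i) l (𝓝 e))
    (hxz : Tendsto (fun i => dist (x i) (z i) / ρ i) l (𝓝 f))
    (hd : 0 < d) (he : 0 < e) (hf : 0 < f)
    (h : 0 < a ∧ 0 < b ∨ 0 < b ∧ 0 < c ∨ 0 < a ∧ 0 < c)
    (hord : ∀ᶠ i in l, (x i, y i, z i) ∈ orderedTriples X) :
    d ^ s₁ + e ^ s₁ = f ^ s₁ := by
  have htop : ∀ {w : ι → X} {q : ℝ}, Tendsto (fun i => dist (w i) p / ρ i) l (𝓝 q) →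
      Tendsto w l (𝓝 p) := by
    intro w q hw
    rw [tendsto_iff_dist_tendsto_zero]
    have := hw.mul hρ0
    rw [mul_zero] at this
    exact this.congr fun i => div_mul_cancel₀ _ (hρ i).ne'
  have htriple : Tendsto (fun i => (x i, y i, z i)) l (𝓝[orderedTriples X] (p, p, p)) :=
    tendsto_nhdsWithin_iff.2
      ⟨(htop hx).prodMk_nhds ((htop hy).prodMk_nhds (htop hz)), hord⟩
  have hrel := hlim.comp htriple
  obtain ⟨δ, hδ, hPhi⟩ := exists_eventually_lt_Phi hρ hx hy hz hxy hyz hxz hd he hf h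
  obtain ⟨K, hK, hPsi⟩ := exists_eventually_Psi_le hρ hxy hyz hxz hd he hf
  -- The factor `Psi / Phi` is eventually at most `K / δ`, so the divergence must come from
  -- `sqRatio`.
  have hsq : Tendsto (fun i => sqRatio s₁ (sExp (x i) (z i) (y i))) l (𝓝 ⊤) := by
    rw [ENNReal.tendsto_nhds_top_iff_nnreal] at hrel ⊢
    intro M
    filter_upwards [hPhi, hPsi, hrel ((K / δ).toNNReal * M)] with i h1 h2 h3
    have h4 := h3.trans_le (ENNReal.div_le_div (mul_le_mul_left h2 _)
      (ENNReal.ofReal_le_ofReal h1.le))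
    by_contra! hle
    refine h4.not_ge ?_
    calc ENNReal.ofReal K * sqRatio s₁ (sExp (x i) (z i) (y i)) / ENNReal.ofReal δ
        ≤ ENNReal.ofReal K * M / ENNReal.ofReal δ := by gcongr
      _ = ENNReal.ofReal (K / δ) * M := by
        rw [ENNReal.ofReal_div_of_pos hδ, ENNReal.mul_div_right_comm]
      _ = _ := by rw [ENNReal.coe_mul]; rfl
  obtain ⟨hfin, hs⟩ := tendsto_toReal_of_sqRatio hs₁ hsq
  refine tendsto_nhds_unique (((hxy.rpow hs (Or.inl hd.ne')).add
    (hyz.rpow hs (Or.inl he.ne'))).congr' ?_) (hxz.rpow hs (Or.inl hf.ne'))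
  filter_upwards [hfin] with i hi
  rw [Real.div_rpow dist_nonneg (hρ i).le, Real.div_rpow dist_nonneg (hρ i).le,
    Real.div_rpow dist_nonneg (hρ i).le, ← add_div, sExp_spec hi]

end Limits

/-! ### Pretangent spaces and tangency -/

section Spaces

variable {X : Type*} [MetricSpace X] {p : X} {r : NormalizingSequence}

/-- Infinitely many ordered indices suffice: `atTop` restricted to them is still a nontrivial
filter, along which all limits persist. -/
theorem Family.Point.rpow_add_rpow_eq {F : Family p r} {s₁ : ℝ} (hs₁ : 0 < s₁)
    (hlim : LimitRelation p s₁) {x y z : F.Point} (hxy : 0 < dist x y) (hyz : 0 < dist y z)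
    (hxz : 0 < dist x z) (hfreq : ∃ᶠ n in atTop, (x.val n, y.val n, z.val n) ∈ orderedTriples X) :
    dist x y ^ s₁ + dist y z ^ s₁ = dist x z ^ s₁ := by
  let o : F.Point := ⟨fun _ => p, F.const_mem⟩
  have hne : (atTop ⊓ 𝓟 {n | (x.val n, y.val n, z.val n) ∈ orderedTriples X}).NeBot :=
    Filter.frequently_mem_iff_neBot.1 hfreq
  have key : ∀ u v : F.Point, Tendsto (fun n => dist (u.val n) (v.val n) / r.seq n)
      (atTop ⊓ 𝓟 {n | (x.val n, y.val n, z.val n) ∈ orderedTriples X}) (𝓝 (dist u v)) :=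
    fun u v => (u.tendsto v).mono_left inf_le_left
  refine hlim.rpow_add_rpow_eq hs₁ (l := atTop ⊓
    𝓟 {n | (x.val n, y.val n, z.val n) ∈ orderedTriples X}) r.pos
    (r.tendsto_zero.mono_left inf_le_left) (key x o) (key y o) (key z o)
    (key x y) (key y z) (key x z) hxy hyz hxz ?_ (mem_inf_of_right (mem_principal_self _))
  -- At most one of three points at positive mutual distances can be at distance zero from `o`.
  have hzero : ∀ {u v : F.Point}, 0 < dist u v → 0 < dist u o ∨ 0 < dist v o := by
    intro u v huv
    by_contra! h
    linarith [dist_triangle_right u v o]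
  have h1 := hzero hxy
  have h2 := hzero hyz
  have h3 := hzero hxz
  tauto

theorem exists_perm_mem_orderedTriples {x y z : X} (hxy : x ≠ y) (hyz : y ≠ z) (hxz : x ≠ z) :
    (x, y, z) ∈ orderedTriples X ∨ (z, y, x) ∈ orderedTriples X ∨
    (x, z, y) ∈ orderedTriples X ∨ (y, z, x) ∈ orderedTriples X ∨
    (y, x, z) ∈ orderedTriples X ∨ (z, x, y) ∈ orderedTriples X := by
  have h1 := dist_pos.2 hxy
  have h2 := dist_pos.2 hyz
  have h3 := dist_pos.2 hxz
  simp only [orderedTriples, Set.mem_ofPred_eq, dist_comm y x, dist_comm z x,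
    dist_comm z y, ge_iff_le, gt_iff_lt, h1, h2, h3, and_true]
  rcases le_total (dist x y) (dist y z) with h4 | h4 <;>
  rcases le_total (dist x y) (dist x z) with h5 | h5 <;>
  rcases le_total (dist y z) (dist x z) with h6 | h6 <;> tauto

/-- Representatives of distinct classes are eventually distinct, so one of the six orderings by side
length occurs infinitely often; its middle entry lies between the other two in the limit. -/
theorem Family.linearTriple {F : Family p r} {s₁ : ℝ} (hs₁ : 0 < s₁)
    (hlim : LimitRelation p s₁) (α β γ : F.Space) :
    LinearTriple (fun a b => dist a b ^ s₁) α β γ := by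
  by_cases h1 : α = β
  · subst h1
    left
    simp [Real.zero_rpow hs₁.ne']
  by_cases h2 : β = γ
  · subst h2
    left
    simp [Real.zero_rpow hs₁.ne']
  by_cases h3 : α = γ
  · subst h3
    right; left
    simp [Real.zero_rpow hs₁.ne']
  obtain ⟨x, rfl⟩ := SeparationQuotient.surjective_mk α
  obtain ⟨y, rfl⟩ := SeparationQuotient.surjective_mk β
  obtain ⟨z, rfl⟩ := SeparationQuotient.surjective_mk γ
  rw [← ne_eq, ← dist_pos, SeparationQuotient.dist_mk] at h1 h2 h3
  simp only [LinearTriple, SeparationQuotient.dist_mk]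
  have hne : ∀ {u v : F.Point}, 0 < dist u v → ∀ᶠ n in atTop, u.val n ≠ v.val n := by
    intro u v huv
    filter_upwards [(u.tendsto v).eventually (lt_mem_nhds huv)] with n hn heq
    simp [heq] at hn
  have hfreq := (((hne h1).and ((hne h2).and (hne h3))).mono fun n hn =>
    exists_perm_mem_orderedTriples hn.1 hn.2.1 hn.2.2).frequently
  have h1' := dist_comm x y ▸ h1
  have h2' := dist_comm y z ▸ h2
  have h3' := dist_comm x z ▸ h3
  simp only [frequently_or_distrib] at hfreq
  rcases hfreq with h | h | h | h | h | h
  · exact Or.inl (Point.rpow_add_rpow_eq hs₁ hlim h1 h2 h3 h)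
  · left
    have := Point.rpow_add_rpow_eq hs₁ hlim h2' h1' h3' h
    rwa [add_comm, dist_comm y x, dist_comm z y, dist_comm z x] at this
  · exact Or.inr (Or.inl (Point.rpow_add_rpow_eq hs₁ hlim h3 h2' h1 h))
  · right; left
    have := Point.rpow_add_rpow_eq hs₁ hlim h2 h3' h1' h
    rwa [add_comm, dist_comm y z, dist_comm z x, dist_comm y x] at this
  · exact Or.inr (Or.inr (Point.rpow_add_rpow_eq hs₁ hlim h1' h3 h2 h))
  · right; right
    have := Point.rpow_add_rpow_eq hs₁ hlim h3' h1 h2' h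
    rwa [add_comm, dist_comm x y, dist_comm z x, dist_comm z y] at this

theorem Family.exists_powIsometry_or_card_eq_four (F : Family p r) {s₁ : ℝ} (hs₁ : 0 < s₁)
    (hlim : LimitRelation p s₁) :
    (∃ f : F.Space → ℝ, PowIsometry s₁ f) ∨ Nat.card F.Space = 4 :=
  exists_embedding_or_card_eq_four (fun a b => dist a b ^ s₁)
    (fun _ _ => Real.rpow_nonneg dist_nonneg _) (fun a b => by rw [dist_comm])
    (fun a b => by rw [Real.rpow_eq_zero dist_nonneg hs₁.ne', dist_eq_zero])
    (F.linearTriple hs₁ hlim)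

theorem Family.isometry_emMap (F : Family p r) {φ : ℕ → ℕ} {hφ : StrictMono φ}
    (F' : Family p (r.subseq φ hφ)) (h : ∀ x ∈ F.carrier, x ∘ φ ∈ F'.carrier) :
    Isometry (F.emMap F' h) := by
  refine Isometry.of_dist_eq fun a b => ?_
  obtain ⟨x, rfl⟩ := SeparationQuotient.surjective_mk a
  obtain ⟨y, rfl⟩ := SeparationQuotient.surjective_mk b
  exact (F.isometry_inMap F' h).dist_eq x y

theorem PowIsometry.comp_isometry {Y Z : Type*} [MetricSpace Y] [MetricSpace Z] {s : ℝ}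
    {f : Z → ℝ} (hf : PowIsometry s f) {g : Y → Z} (hg : Isometry g) : PowIsometry s (f ∘ g) :=
  fun a b => by rw [Function.comp, Function.comp, hf, hg.dist_eq]

theorem PowIsometry.injective {Y : Type*} [MetricSpace Y] {s : ℝ} (hs : 0 < s) {f : Y → ℝ}
    (hf : PowIsometry s f) : Function.Injective f := fun a b hab => by
  have := hf a b
  rw [hab, sub_self, abs_zero, eq_comm, Real.rpow_eq_zero dist_nonneg hs.ne'] at this
  exact dist_eq_zero.1 this

/-- If one power-isometry into the line is onto, then so is every other one. -/
theorem PowIsometry.surjective_of_surjective {Y : Type*} [MetricSpace Y] {s : ℝ} {f g : Y → ℝ}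
    (hf : PowIsometry s f) (hsurj : Function.Surjective f) (hg : PowIsometry s g) :
    Function.Surjective g := by
  obtain ⟨k, hk⟩ := hsurj.hasRightInverse
  have hiso : Isometry (g ∘ k) := Isometry.of_dist_eq fun a b => by
    rw [Real.dist_eq, Real.dist_eq, Function.comp, Function.comp, hg, ← hf, hk, hk]
  intro t
  -- With `u = t - (g ∘ k) 0`, the isometry sends each of `u`, `-u` to `(g ∘ k) 0 + u = t` or to `(g
  -- ∘ k) 0 - u`. If both go to the latter, then `u = 0` and the two values agree.
  obtain ⟨a, ha⟩ : ∃ a, (g ∘ k) a = t := by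
    have h0 := fun a => hiso.dist_eq a 0
    have hd := hiso.dist_eq (t - (g ∘ k) 0) ((g ∘ k) 0 - t)
    have h1 := h0 (t - (g ∘ k) 0)
    have h2 := h0 ((g ∘ k) 0 - t)
    simp only [Real.dist_eq, sub_zero] at h1 h2 hd
    rcases abs_eq_abs.1 h1 with h | h
    · exact ⟨t - (g ∘ k) 0, by linarith⟩
    rcases abs_eq_abs.1 h2 with h' | h'
    · refine ⟨t - (g ∘ k) 0, ?_⟩
      rw [show (g ∘ k) (t - (g ∘ k) 0) = (g ∘ k) ((g ∘ k) 0 - t) by linarith, sub_self,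
        abs_zero, eq_comm, abs_eq_zero] at hd
      linarith
    · exact ⟨(g ∘ k) 0 - t, by linarith⟩
  exact ⟨k a, ha⟩

theorem Family.isTangent_of_not_exists_powIsometry (F : Family p r) {s₁ : ℝ} (hs₁ : 0 < s₁)
    (hlim : LimitRelation p s₁) (h : ¬ ∃ f : F.Space → ℝ, PowIsometry s₁ f) : F.IsTangent := by
  intro φ hφ F' hF'
  have hiso := F.isometry_emMap F' hF'
  have hcard := (F.exists_powIsometry_or_card_eq_four hs₁ hlim).resolve_left h
  -- An embedding of the larger space would restrict to the smaller one along `em'`.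
  have hcard' := (F'.exists_powIsometry_or_card_eq_four hs₁ hlim).resolve_left
    fun ⟨f, hf⟩ => h ⟨_, hf.comp_isometry hiso⟩
  have : Finite F'.Space := Nat.finite_of_card_ne_zero (by omega)
  exact ⟨hiso, (hiso.injective.bijective_of_nat_card_le (by omega)).2⟩

theorem Family.isTangent_of_surjective_powIsometry (F : Family p r) {s₁ : ℝ} (hs₁ : 0 < s₁)
    (hlim : LimitRelation p s₁) {f : F.Space → ℝ} (hf : PowIsometry s₁ f)
    (hsurj : Function.Surjective f) : F.IsTangent := by
  intro φ hφ F' hF'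
  have hiso := F.isometry_emMap F' hF'
  have : Infinite F.Space := Infinite.of_surjective f hsurj
  have : Infinite F'.Space := Infinite.of_injective _ hiso.injective
  obtain ⟨g, hg⟩ := (F'.exists_powIsometry_or_card_eq_four hs₁ hlim).resolve_right
    (by rw [Nat.card_eq_zero_of_infinite]; norm_num)
  refine ⟨hiso, fun b => ?_⟩
  -- Rigidity of the line makes `g ∘ em'` onto; injectivity of `g` carries this back to `em'`.
  obtain ⟨a, ha⟩ := hf.surjective_of_surjective hsurj (hg.comp_isometry hiso) (g b)
  exact ⟨a, hg.injective hs₁ ha⟩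

end Spaces

end Pretangent

theorem corollary3p4 {X : Type*} [MetricSpace X] (p : X) (hp : AccPt p (Filter.principal Set.univ))
    (r : Pretangent.NormalizingSequence) (F : Pretangent.Family p r)
    (s₁ : ℝ) (hs₁ : 0 < s₁) (hlim : Pretangent.LimitRelation p s₁) :
    ((¬ ∃ f : F.Space → ℝ, Pretangent.PowIsometry s₁ f) → F.IsTangent) ∧
    ((∃ f : F.Space → ℝ, Pretangent.PowIsometry s₁ f ∧ Function.Surjective f) → F.IsTangent) :=
  ⟨F.isTangent_of_not_exists_powIsometry hs₁ hlim,
    fun ⟨_, hf, hsurj⟩ => F.isTangent_of_surjective_powIsometry hs₁ hlim hf hsurj⟩
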